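/- Let $\lambda>0$ be a real number, let $\mathrm{Po}(\lambda)$ denote the Poisson distribution with mean $\lambda$, and let $D(P\Vert Q)=\sum_x P(x)\ln\frac{P(x)}{Q(x)}\in[0,\infty]$ denote the information divergence of discrete probability distributions, with natural logarithms and with $D(P\Vert Q)=\infty$ if $P$ is not absolutely continuous with respect to $Q$; write $D(X\Vert Q)$ for $D(P\Vert Q)$ when $X$ has distribution $P$. 1. If $X$ is a discrete real-valued random variable with $\mathrm{E}[X]=\lambda$, then $$2\,D\bigl(X\Vert\mathrm{Po}(\lambda)\bigr)^{1/2}\;\geq\;1-\frac{\mathrm{Var}(X)}{\lambda}.$$ Here $\mathrm{Var}(X)$ and $D(X\Vert\mathrm{Po}(\lambda))$ are allowed to be $+\infty$, and the inequality is read in $[-\infty,\infty]$. 2. In particular, for every integer $n\geq 1$ with $n\geq\lambda$, the binomial distribution $\mathrm{Bi}(n,\lambda/n)$ satisfies $$D\bigl(\mathrm{Bi}(n,\lambda/n)\Vert\mathrm{Po}(\lambda)\bigr)\;\geq\;\frac{\lambda^{2}}{4n^{2}}.$$ -/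

import Mathlib

open MeasureTheory ProbabilityTheory InformationTheory
open scoped NNReal ENNReal

/-!
Write `Y = n - lam` for a Poisson variable `n` of mean `lam`. By the Donsker–Varadhan inequality,
for all real `b` and all `τ ≥ 0`, a law of mean `lam` and variance `V` has divergence at least
`τ (lam - V) - log Z`, where `Z` is the Poisson expectation of `exp (b Y - τ (Y ^ 2 - lam))`; the
linear term drops out because the mean is `lam`. It therefore suffices to find, for every `τ ≥ 0`,
some `b` with `log Z ≤ lam ^ 2 τ ^ 2` (`exists_integral_exp_quadratic_le`), and to take
`τ = (lam - V) / (2 lam ^ 2)`.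

The right `b = b(τ)` is the one for which the law with a density, relative to the Poisson law,
proportional to `exp (b Y - τ Y ^ 2)` again has mean `lam`. Along this curve the derivative of
`log Z` in `τ` is `lam - v(τ)`, where `v(τ)` is the variance of that law, so what is needed is
`v(τ) ≥ lam - 2 lam ^ 2 τ` (`le_integral_sq_mul_exp`). The Stein–Chen identity of the Poisson law
turns into one for the weighted law, in which the weight contributes a shift of the tilt `b` to
`b - 2 τ` (`stein_mgf`, `stein_deriv_mgf`). If `ψ(b)` denotes the mean of `Y` under the tilt `b`,
it reads `v(τ) = lam (1 + ψ(b - 2 τ))`. The same identities show that all these laws have variance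
at most their mean (`deriv_deriv_cgf_le`); hence `ψ' ≤ ψ + lam ≤ lam` below `b`, and
`ψ(b - 2 τ) ≥ -2 lam τ`.

Differentiating `b(τ)` is avoided: Jensen's inequality gives the increment bound
`log Z(t) - log Z(s) ≤ 2 lam ^ 2 t (t - s)` directly (`integral_exp_quadratic_mul_exp_le`), and
summing it over finer and finer partitions gives `log Z(τ) ≤ lam ^ 2 τ ^ 2`
(`le_add_mul_sq_of_sub_le`).

The binomial law has variance `lam (1 - lam / n)`, so the second bound is a case of the first.
-/

/-! ### Exponential moments and the Stein–Chen identity of the Poisson law -/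

lemma integrable_exp_mul_poissonMeasure (lam : ℝ≥0) (t : ℝ) :
    Integrable (fun n : ℕ ↦ Real.exp (t * n)) (poissonMeasure lam) := by
  rw [integrable_poissonMeasure_iff]
  have h := (Real.summable_pow_div_factorial (lam * Real.exp t)).mul_left (Real.exp (-lam))
  refine h.congr fun n ↦ ?_
  rw [Real.norm_eq_abs, abs_of_pos (Real.exp_pos _), mul_comm t, Real.exp_nat_mul]
  ring

/-- The Stein–Chen identity of the Poisson law. No integrability is needed: the two series converge
or diverge together. -/
lemma integral_natCast_mul_poissonMeasure (lam : ℝ≥0) (f : ℕ → ℝ) :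
    ∫ n, (n : ℝ) * f n ∂(poissonMeasure lam) = lam * ∫ n, f (n + 1) ∂(poissonMeasure lam) := by
  rw [integral_poissonMeasure, integral_poissonMeasure, ← tsum_mul_left]
  set g : ℕ → ℝ := fun n ↦ (Real.exp (-lam) * (lam : ℝ) ^ n / n.factorial) • ((n : ℝ) * f n)
  have hg (n : ℕ) : g (n + 1) =
      lam * ((Real.exp (-lam) * (lam : ℝ) ^ n / n.factorial) • f (n + 1)) := by
    simp only [g, smul_eq_mul, Nat.factorial_succ]
    push_cast
    field_simp
    ring
  simp_rw [← hg]
  by_cases h : Summable (fun n ↦ g (n + 1))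
  · rw [tsum_eq_zero_add' h]
    simp [g]
  · rw [tsum_eq_zero_of_not_summable h, tsum_eq_zero_of_not_summable]
    rwa [← summable_nat_add_iff 1]

/-! ### Centred exponential tilts and integration of increments -/

/-- If a random variable exceeds some `a > 0`, and falls below some `c < 0`, with positive
probability, then some exponential tilt of its law is centred: the moment generating function is
coercive, and its derivative vanishes at a minimum. -/
theorem exists_integral_mul_exp_eq_zero {Ω : Type*} [MeasurableSpace Ω] {μ : Measure Ω}
    [IsFiniteMeasure μ] {X : Ω → ℝ} (hX : ∀ t, Integrable (fun ω ↦ Real.exp (t * X ω)) μ)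
    {a c : ℝ} (ha : 0 < a) (hc : c < 0) (hpos : 0 < μ.real {ω | a ≤ X ω})
    (hneg : 0 < μ.real {ω | X ω ≤ c}) :
    ∃ b, ∫ ω, X ω * Real.exp (b * X ω) ∂μ = 0 := by
  have hint (t : ℝ) : t ∈ interior (integrableExpSet X μ) := by
    have : integrableExpSet X μ = Set.univ := Set.eq_univ_of_forall hX
    simp [this]
  have htop : Filter.Tendsto (mgf X μ) Filter.atTop Filter.atTop := by
    have h1 : Filter.Tendsto (fun t : ℝ ↦ Real.exp (a * t) * μ.real {ω | a ≤ X ω})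
        Filter.atTop Filter.atTop :=
      (Real.tendsto_exp_atTop.comp (Filter.tendsto_id.const_mul_atTop ha)).atTop_mul_const hpos
    refine Filter.tendsto_atTop_mono' _ ?_ h1
    filter_upwards [Filter.eventually_ge_atTop 0] with t ht
    have h := measure_ge_le_exp_mul_mgf a ht (hX t)
    calc _ ≤ Real.exp (a * t) * (Real.exp (-t * a) * mgf X μ t) := by gcongr
      _ = mgf X μ t := by
        rw [← mul_assoc, ← Real.exp_add, show a * t + -t * a = 0 by ring, Real.exp_zero, one_mul]
  have hbot : Filter.Tendsto (mgf X μ) Filter.atBot Filter.atTop := by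
    have h1 : Filter.Tendsto (fun t : ℝ ↦ Real.exp (c * t) * μ.real {ω | X ω ≤ c})
        Filter.atBot Filter.atTop :=
      (Real.tendsto_exp_atTop.comp
        (Filter.tendsto_id.const_mul_atBot_of_neg hc)).atTop_mul_const hneg
    refine Filter.tendsto_atTop_mono' _ ?_ h1
    filter_upwards [Filter.eventually_le_atBot 0] with t ht
    have h := measure_le_le_exp_mul_mgf c ht (hX t)
    calc _ ≤ Real.exp (c * t) * (Real.exp (-t * c) * mgf X μ t) := by gcongr
      _ = mgf X μ t := by
        rw [← mul_assoc, ← Real.exp_add, show c * t + -t * c = 0 by ring, Real.exp_zero, one_mul]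
  have hcoc : Filter.Tendsto (mgf X μ) (Filter.cocompact ℝ) Filter.atTop := by
    rw [cocompact_eq_atBot_atTop]
    exact hbot.sup htop
  obtain ⟨b, hb⟩ := (continuous_mgf hX).exists_forall_le hcoc
  refine ⟨b, ?_⟩
  rw [← deriv_mgf (hint b)]
  exact IsLocalMin.deriv_eq_zero (Filter.Eventually.of_forall hb)

/-- A function whose increments satisfy `G t - G s ≤ 2 c t (t - s)` grows at most like `c t ^ 2`,
because the sum of these bounds over a fine uniform partition is a Riemann sum of `∫ 2 c u du`.
Neither continuity nor differentiability of `G` is assumed. -/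
theorem le_add_mul_sq_of_sub_le {G : ℝ → ℝ} {c : ℝ}
    (h : ∀ s t, 0 ≤ s → s ≤ t → G t - G s ≤ 2 * c * t * (t - s)) {t : ℝ} (ht : 0 ≤ t) :
    G t ≤ G 0 + c * t ^ 2 := by
  have key (N : ℕ) : G t ≤ G 0 + c * t ^ 2 + c * t ^ 2 * (1 / ((N : ℝ) + 1)) := by
    set d : ℝ := t / (N + 1) with hd
    have hd0 : 0 ≤ d := by positivity
    have ind (k : ℕ) : G (k * d) ≤ G 0 + c * d ^ 2 * (k * (k + 1)) := by
      induction k with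
      | zero => simp
      | succ k ih =>
        have := h (k * d) ((k + 1 : ℕ) * d) (by positivity) (by gcongr; simp)
        push_cast at this ⊢
        nlinarith
    have h1 := ind (N + 1)
    have h2 : ((N + 1 : ℕ) : ℝ) * d = t := by rw [hd]; push_cast; field_simp
    rw [h2] at h1
    refine h1.trans (le_of_eq ?_)
    rw [hd]; push_cast; field_simp; ring
  have hlim : Filter.Tendsto (fun N : ℕ ↦ G 0 + c * t ^ 2 + c * t ^ 2 * (1 / ((N : ℝ) + 1)))
      Filter.atTop (nhds (G 0 + c * t ^ 2 + c * t ^ 2 * 0)) :=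
    (tendsto_one_div_add_atTop_nhds_zero_nat.const_mul _).const_add _
  simpa using ge_of_tendsto' hlim key

/-! ### The variational lower bound on the divergence -/

/-- The lower bound of the Donsker–Varadhan formula. It is Gibbs' inequality for `μ` against the
tilted measure `ν.tilted f`. -/
theorem integral_sub_log_integral_exp_le_toReal_klDiv {α : Type*} [MeasurableSpace α]
    {μ ν : Measure α} [IsProbabilityMeasure μ] [IsProbabilityMeasure ν] {f : α → ℝ}
    (hfμ : Integrable f μ) (hfν : Integrable (fun x ↦ Real.exp (f x)) ν) (hkl : klDiv μ ν ≠ ∞) :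
    ∫ x, f x ∂μ - Real.log (∫ x, Real.exp (f x) ∂ν) ≤ (klDiv μ ν).toReal := by
  obtain ⟨hac, hllr⟩ := klDiv_ne_top_iff.1 hkl
  have := isProbabilityMeasure_tilted hfν
  have h1 := integral_llr_tilted_right hac hfμ hfν hllr
  have h2 := integral_llr_add_sub_measure_univ_nonneg
    (hac.trans (absolutelyContinuous_tilted hfν)) (integrable_llr_tilted_right hac hfμ hllr hfν)
  rw [toReal_klDiv_of_measure_eq hac (by simp)]
  simp only [probReal_univ, add_sub_cancel_right] at h2
  linarith

/-! ### The Poisson law with a Gaussian weight -/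

/-- The Poisson law multiplied by the Gaussian weight `exp (-τ (n - lam) ^ 2)`. It is not
normalized; the normalizing constant and the exponential tilt by `b (n - lam)` enter through the
moment generating function of `n - lam`. -/
noncomputable def gaussWeightedPoisson (lam : ℝ≥0) (τ : ℝ) : Measure ℕ :=
  (poissonMeasure lam).withDensity fun n ↦ ENNReal.ofReal (Real.exp (-τ * ((n : ℝ) - lam) ^ 2))

lemma integral_gaussWeightedPoisson (lam : ℝ≥0) (τ : ℝ) (g : ℕ → ℝ) :
    ∫ n, g n ∂(gaussWeightedPoisson lam τ) =
      ∫ n : ℕ, Real.exp (-τ * ((n : ℝ) - lam) ^ 2) * g n ∂(poissonMeasure lam) := by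
  rw [gaussWeightedPoisson, integral_withDensity_eq_integral_toReal_smul .of_discrete (by simp)]
  simp [ENNReal.toReal_ofReal (Real.exp_pos _).le]

lemma integrable_exp_neg_mul_sq_mul {lam : ℝ≥0} {τ : ℝ} (hτ : 0 ≤ τ) {g : ℕ → ℝ}
    (hg : Integrable g (poissonMeasure lam)) :
    Integrable (fun n : ℕ ↦ Real.exp (-τ * ((n : ℝ) - lam) ^ 2) * g n) (poissonMeasure lam) := by
  refine hg.mono .of_discrete (Filter.Eventually.of_forall fun n ↦ ?_)
  rw [norm_mul, Real.norm_eq_abs, abs_of_pos (Real.exp_pos _)]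
  refine mul_le_of_le_one_left (norm_nonneg _) (Real.exp_le_one_iff.2 ?_)
  rw [neg_mul, neg_nonpos]
  positivity

lemma integrable_gaussWeightedPoisson_of_integrable {lam : ℝ≥0} {τ : ℝ} (hτ : 0 ≤ τ) {g : ℕ → ℝ}
    (hg : Integrable g (poissonMeasure lam)) : Integrable g (gaussWeightedPoisson lam τ) := by
  rw [gaussWeightedPoisson, integrable_withDensity_iff_integrable_smul' .of_discrete (by simp)]
  simpa [ENNReal.toReal_ofReal (Real.exp_pos _).le] using integrable_exp_neg_mul_sq_mul hτ hg

lemma integrable_exp_mul_sub_poissonMeasure (lam : ℝ≥0) (a b : ℝ) :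
    Integrable (fun n : ℕ ↦ Real.exp (b * ((n : ℝ) - a))) (poissonMeasure lam) := by
  refine ((integrable_exp_mul_poissonMeasure lam b).const_mul (Real.exp (-(b * a)))).congr
    (Filter.Eventually.of_forall fun n ↦ ?_)
  simp only
  rw [← Real.exp_add]
  ring_nf

lemma integrable_exp_mul_gaussWeightedPoisson (lam : ℝ≥0) {τ : ℝ} (hτ : 0 ≤ τ) (b : ℝ) :
    Integrable (fun n : ℕ ↦ Real.exp (b * ((n : ℝ) - lam))) (gaussWeightedPoisson lam τ) :=
  integrable_gaussWeightedPoisson_of_integrable hτ (integrable_exp_mul_sub_poissonMeasure lam lam b)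

lemma isFiniteMeasure_gaussWeightedPoisson (lam : ℝ≥0) {τ : ℝ} (hτ : 0 ≤ τ) :
    IsFiniteMeasure (gaussWeightedPoisson lam τ) := by
  have h := integrable_exp_mul_gaussWeightedPoisson lam hτ 0
  simp only [zero_mul, Real.exp_zero] at h
  exact (integrable_const_iff_isFiniteMeasure one_ne_zero).1 h

lemma mem_interior_integrableExpSet_gaussWeightedPoisson (lam : ℝ≥0) {τ : ℝ} (hτ : 0 ≤ τ) (b : ℝ) :
    b ∈ interior
      (integrableExpSet (fun n : ℕ ↦ (n : ℝ) - lam) (gaussWeightedPoisson lam τ)) := by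
  have : integrableExpSet (fun n : ℕ ↦ (n : ℝ) - lam) (gaussWeightedPoisson lam τ) = Set.univ :=
    Set.eq_univ_of_forall (integrable_exp_mul_gaussWeightedPoisson lam hτ)
  simp [this]

lemma gaussWeightedPoisson_singleton_pos {lam : ℝ≥0} (hlam : 0 < lam) (τ : ℝ) (n : ℕ) :
    0 < gaussWeightedPoisson lam τ {n} := by
  rw [gaussWeightedPoisson, withDensity_apply _ (by simp), Measure.restrict_singleton]
  simp only [lintegral_smul_measure, lintegral_dirac]
  have h := poissonMeasure_real_singleton_pos n hlam
  have h1 : 0 < (poissonMeasure lam) {n} := by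
    rw [pos_iff_ne_zero]; intro h0; simp [measureReal_def, h0] at h
  exact ENNReal.mul_pos h1.ne' (by simp [Real.exp_pos])

lemma gaussWeightedPoisson_ne_zero {lam : ℝ≥0} (hlam : 0 < lam) (τ : ℝ) :
    gaussWeightedPoisson lam τ ≠ 0 := by
  intro h
  have := gaussWeightedPoisson_singleton_pos hlam τ 0
  simp [h] at this

lemma mgf_gaussWeightedPoisson_pos {lam : ℝ≥0} (hlam : 0 < lam) {τ : ℝ} (hτ : 0 ≤ τ) (b : ℝ) :
    0 < mgf (fun n : ℕ ↦ (n : ℝ) - lam) (gaussWeightedPoisson lam τ) b :=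
  mgf_pos' (gaussWeightedPoisson_ne_zero hlam τ) (integrable_exp_mul_gaussWeightedPoisson lam hτ b)

/-! ### Variance of the weighted laws -/

/-- The Stein–Chen identity after weighting: the constant factor `lam` is replaced by
`lam * w (n + 1) / w n` with `w n = exp (-τ (n - lam) ^ 2)`, which is an exponential in `n`. -/
lemma integral_natCast_mul_gaussWeightedPoisson (lam : ℝ≥0) (τ : ℝ) (g : ℕ → ℝ) :
    ∫ n, (n : ℝ) * g n ∂(gaussWeightedPoisson lam τ) =
      ∫ n : ℕ, lam * Real.exp (-τ * (2 * ((n : ℝ) - lam) + 1)) * g (n + 1)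
        ∂(gaussWeightedPoisson lam τ) := by
  rw [integral_gaussWeightedPoisson, integral_gaussWeightedPoisson]
  simp_rw [mul_left_comm _ ((_ : ℕ) : ℝ)]
  rw [integral_natCast_mul_poissonMeasure, ← integral_const_mul]
  refine integral_congr_ae (Filter.Eventually.of_forall fun n ↦ ?_)
  simp only [← mul_assoc]
  rw [mul_comm (Real.exp _) (lam : ℝ), mul_assoc (lam : ℝ) _ (Real.exp _), ← Real.exp_add]
  push_cast
  ring_nf

/-- The Stein–Chen identity for the function `exp (b (n - lam))`. Since the factor
`lam * w (n + 1) / w n` is itself an exponential in `n`, it turns the tilt `b` into `b - 2 τ`. -/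
lemma stein_mgf (lam : ℝ≥0) {τ : ℝ} (hτ : 0 ≤ τ) (b : ℝ) :
    (∫ n : ℕ, ((n : ℝ) - lam) * Real.exp (b * ((n : ℝ) - lam)) ∂(gaussWeightedPoisson lam τ)) +
      lam * mgf (fun n : ℕ ↦ (n : ℝ) - lam) (gaussWeightedPoisson lam τ) b =
    lam * Real.exp (b - τ) *
      mgf (fun n : ℕ ↦ (n : ℝ) - lam) (gaussWeightedPoisson lam τ) (b - 2 * τ) := by
  have h := integral_natCast_mul_gaussWeightedPoisson lam τ
    (fun n ↦ Real.exp (b * ((n : ℝ) - lam)))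
  have hm := mem_interior_integrableExpSet_gaussWeightedPoisson lam hτ b
  have i1 := integrable_pow_mul_exp_of_mem_interior_integrableExpSet hm 1
  have i0 := integrable_exp_mul_gaussWeightedPoisson lam hτ b
  simp only [pow_one] at i1
  simp only [mgf]
  rw [← integral_const_mul, ← integral_const_mul, ← integral_add i1 (i0.const_mul _)]
  convert h using 1
  · refine integral_congr_ae (Filter.Eventually.of_forall fun n ↦ ?_)
    simp only; ring
  · refine integral_congr_ae (Filter.Eventually.of_forall fun n ↦ ?_)
    simp only
    rw [mul_assoc, mul_assoc, ← Real.exp_add, ← Real.exp_add]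
    push_cast; ring_nf

/-- The Stein–Chen identity for the function `(n - lam) exp (b (n - lam))`. -/
lemma stein_deriv_mgf (lam : ℝ≥0) {τ : ℝ} (hτ : 0 ≤ τ) (b : ℝ) :
    (∫ n : ℕ, ((n : ℝ) - lam) ^ 2 * Real.exp (b * ((n : ℝ) - lam))
        ∂(gaussWeightedPoisson lam τ)) +
      lam * ∫ n : ℕ, ((n : ℝ) - lam) * Real.exp (b * ((n : ℝ) - lam))
        ∂(gaussWeightedPoisson lam τ) =
    lam * Real.exp (b - τ) *
      ((∫ n : ℕ, ((n : ℝ) - lam) * Real.exp ((b - 2 * τ) * ((n : ℝ) - lam))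
          ∂(gaussWeightedPoisson lam τ)) +
        mgf (fun n : ℕ ↦ (n : ℝ) - lam) (gaussWeightedPoisson lam τ) (b - 2 * τ)) := by
  have h := integral_natCast_mul_gaussWeightedPoisson lam τ
    (fun n ↦ ((n : ℝ) - lam) * Real.exp (b * ((n : ℝ) - lam)))
  have hm := mem_interior_integrableExpSet_gaussWeightedPoisson lam hτ
  have i2 := integrable_pow_mul_exp_of_mem_interior_integrableExpSet (hm b) 2
  have i1 := integrable_pow_mul_exp_of_mem_interior_integrableExpSet (hm b) 1
  have j1 := integrable_pow_mul_exp_of_mem_interior_integrableExpSet (hm (b - 2 * τ)) 1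
  have j0 := integrable_exp_mul_gaussWeightedPoisson lam hτ (b - 2 * τ)
  simp only [pow_one] at i1 j1
  simp only [mgf]
  rw [← integral_add j1 j0, ← integral_const_mul, ← integral_const_mul,
    ← integral_add i2 (i1.const_mul _)]
  convert h using 1
  · refine integral_congr_ae (Filter.Eventually.of_forall fun n ↦ ?_)
    simp only; ring
  · refine integral_congr_ae (Filter.Eventually.of_forall fun n ↦ ?_)
    simp only
    have : lam * Real.exp (-τ * (2 * ((n : ℝ) - lam) + 1)) *
        ((((n + 1 : ℕ) : ℝ) - lam) * Real.exp (b * (((n + 1 : ℕ) : ℝ) - lam))) =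
        lam * (((n + 1 : ℕ) : ℝ) - lam) * (Real.exp (-τ * (2 * ((n : ℝ) - lam) + 1)) *
          Real.exp (b * (((n + 1 : ℕ) : ℝ) - lam))) := by ring
    rw [this, ← Real.exp_add, ← add_one_mul, mul_mul_mul_comm, ← Real.exp_add]
    push_cast; ring_nf

lemma differentiable_deriv_cgf {Ω : Type*} [MeasurableSpace Ω] {μ : Measure Ω} {X : Ω → ℝ}
    (hint : ∀ t, t ∈ interior (integrableExpSet X μ)) : Differentiable ℝ (deriv (cgf X μ)) :=
  fun t ↦ (analyticAt_cgf (hint t)).deriv.differentiableAt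

lemma monotone_deriv_cgf {Ω : Type*} [MeasurableSpace Ω] {μ : Measure Ω} {X : Ω → ℝ}
    (hint : ∀ t, t ∈ interior (integrableExpSet X μ)) : Monotone (deriv (cgf X μ)) := by
  refine monotone_of_deriv_nonneg (differentiable_deriv_cgf hint) fun t ↦ ?_
  have h := iteratedDeriv_two_cgf_eq_integral (hint t)
  rw [iteratedDeriv_succ, iteratedDeriv_one] at h
  rw [h]
  exact div_nonneg (integral_nonneg fun ω ↦ by positivity) mgf_nonneg

/-- Every exponential tilt of the weighted Poisson law has variance at most its mean. Here
`deriv (deriv cgf) b` is the variance of the tilted law, and `deriv cgf b + lam` is the mean of `n`.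
By the two Stein–Chen identities `E[n (n - lam)] = E[n] (1 + E'[n - lam])`, where `E'` is the
expectation for the smaller tilt `b - 2 τ`, and `E'[n - lam] ≤ E[n - lam]` by convexity of `cgf`. -/
lemma deriv_deriv_cgf_le {lam : ℝ≥0} (hlam : 0 < lam) {τ : ℝ} (hτ : 0 ≤ τ) (b : ℝ) :
    deriv (deriv (cgf (fun n : ℕ ↦ (n : ℝ) - lam) (gaussWeightedPoisson lam τ))) b ≤
      deriv (cgf (fun n : ℕ ↦ (n : ℝ) - lam) (gaussWeightedPoisson lam τ)) b + lam := by
  have hm := mem_interior_integrableExpSet_gaussWeightedPoisson lam hτ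
  have h2 := iteratedDeriv_two_cgf (hm b)
  rw [iteratedDeriv_succ, iteratedDeriv_one] at h2
  have hmono := monotone_deriv_cgf hm (show b - 2 * τ ≤ b by linarith)
  rw [h2]
  rw [deriv_cgf (hm b), deriv_cgf (hm (b - 2 * τ))] at *
  have s1 := stein_mgf lam hτ b
  have s2 := stein_deriv_mgf lam hτ b
  have p0 := mgf_gaussWeightedPoisson_pos hlam hτ b
  have q0 := mgf_gaussWeightedPoisson_pos hlam hτ (b - 2 * τ)
  set A0 := mgf (fun n : ℕ ↦ (n : ℝ) - lam) (gaussWeightedPoisson lam τ) b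
  set B0 := mgf (fun n : ℕ ↦ (n : ℝ) - lam) (gaussWeightedPoisson lam τ) (b - 2 * τ)
  set A1 := ∫ n : ℕ, ((n : ℝ) - lam) * Real.exp (b * ((n : ℝ) - lam)) ∂(gaussWeightedPoisson lam τ)
  set A2 := ∫ n : ℕ, ((n : ℝ) - lam) ^ 2 * Real.exp (b * ((n : ℝ) - lam))
    ∂(gaussWeightedPoisson lam τ)
  set B1 := ∫ n : ℕ, ((n : ℝ) - lam) * Real.exp ((b - 2 * τ) * ((n : ℝ) - lam))
    ∂(gaussWeightedPoisson lam τ)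
  have hB : B1 ≤ A1 / A0 * B0 := (div_le_iff₀ q0).1 hmono
  have hc : 0 ≤ lam * Real.exp (b - τ) := by positivity
  have h : A2 + lam * A1 ≤ (A1 / A0 + 1) * (A1 + lam * A0) := by
    rw [s1, s2]
    nlinarith [mul_le_mul_of_nonneg_left hB hc]
  have hA : A1 = A1 / A0 * A0 := by field_simp
  generalize A1 / A0 = m at *
  rw [hA] at h
  have : A2 / A0 ≤ m ^ 2 + m + lam := by
    rw [div_le_iff₀ p0]
    nlinarith
  linarith

/-- If the tilted weighted law has mean `lam`, then its variance is at least `lam - 2 lam ^ 2 τ`.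
By the Stein–Chen identities the variance is `lam (1 + ψ (b - 2 τ))` with `ψ = deriv cgf` and
`ψ b = 0`. Tilts below `b` have mean at most `lam`, so their variance `ψ'` is at most `lam` as
well, whence `ψ (b - 2 τ) ≥ -2 lam τ`. -/
lemma le_integral_sq_mul_exp {lam : ℝ≥0} (hlam : 0 < lam) {τ : ℝ} (hτ : 0 ≤ τ) {b : ℝ}
    (hb : ∫ n : ℕ, ((n : ℝ) - lam) * Real.exp (b * ((n : ℝ) - lam))
      ∂(gaussWeightedPoisson lam τ) = 0) :
    (lam - 2 * lam ^ 2 * τ) *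
        mgf (fun n : ℕ ↦ (n : ℝ) - lam) (gaussWeightedPoisson lam τ) b ≤
      ∫ n : ℕ, ((n : ℝ) - lam) ^ 2 * Real.exp (b * ((n : ℝ) - lam))
        ∂(gaussWeightedPoisson lam τ) := by
  have hm := mem_interior_integrableExpSet_gaussWeightedPoisson lam hτ
  set ψ := deriv (cgf (fun n : ℕ ↦ (n : ℝ) - lam) (gaussWeightedPoisson lam τ)) with hψ
  have hψb : ψ b = 0 := by rw [hψ, deriv_cgf (hm b), hb, zero_div]
  have hmono : Monotone ψ := monotone_deriv_cgf hm
  have hmvt : ψ b - ψ (b - 2 * τ) ≤ lam * (b - (b - 2 * τ)) := by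
    refine (convex_Iic b).image_sub_le_mul_sub_of_deriv_le
      (differentiable_deriv_cgf hm).continuous.continuousOn
      (differentiable_deriv_cgf hm).differentiableOn (fun x hx ↦ ?_) _ ?_ _ ?_ ?_
    · have h1 := deriv_deriv_cgf_le hlam hτ x
      have h2 := hmono (Set.mem_Iic.1 (interior_subset hx))
      rw [hψb] at h2
      exact h1.trans (by linarith)
    · simp [hτ]
    · simp
    · linarith
  have hψ2 : ψ (b - 2 * τ) = _ := deriv_cgf (hm (b - 2 * τ))
  rw [hψb, hψ2] at hmvt
  have s1 := stein_mgf lam hτ b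
  have s2 := stein_deriv_mgf lam hτ b
  rw [hb] at s1 s2
  have q0 := mgf_gaussWeightedPoisson_pos hlam hτ (b - 2 * τ)
  set B0 := mgf (fun n : ℕ ↦ (n : ℝ) - lam) (gaussWeightedPoisson lam τ) (b - 2 * τ)
  set B1 := ∫ n : ℕ, ((n : ℝ) - lam) * Real.exp ((b - 2 * τ) * ((n : ℝ) - lam))
    ∂(gaussWeightedPoisson lam τ)
  have h3 : -(2 * lam * τ) * B0 ≤ B1 := by
    rw [← le_div_iff₀ q0]; linarith
  have hc : 0 ≤ lam * Real.exp (b - τ) := by positivity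
  have h4 := mul_le_mul_of_nonneg_left h3 hc
  calc _ = (1 - 2 * lam * τ) * (0 + lam *
        mgf (fun n : ℕ ↦ (n : ℝ) - lam) (gaussWeightedPoisson lam τ) b) := by ring
    _ ≤ _ := by
      rw [s1]
      linarith

/-! ### The partition function of the quadratic exponential family -/

/-- Jensen's inequality for the exponential function and the probability measure proportional to
`exp f • ν`: the number `c` is a lower bound for the mean of `g - f`. -/
theorem integral_exp_mul_exp_le_integral_exp {α : Type*} [MeasurableSpace α] {ν : Measure α}
    {f g : α → ℝ} {c : ℝ} (hf : Integrable (fun x ↦ Real.exp (f x)) ν)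
    (hg : Integrable (fun x ↦ Real.exp (g x)) ν)
    (hfg : Integrable (fun x ↦ (g x - f x) * Real.exp (f x)) ν)
    (hc : c * ∫ x, Real.exp (f x) ∂ν ≤ ∫ x, (g x - f x) * Real.exp (f x) ∂ν) :
    (∫ x, Real.exp (f x) ∂ν) * Real.exp c ≤ ∫ x, Real.exp (g x) ∂ν := by
  have h1 : ∫ x, Real.exp c * ((1 - c) * Real.exp (f x) + (g x - f x) * Real.exp (f x)) ∂ν ≤
      ∫ x, Real.exp (g x) ∂ν := by
    -- The tangent line of the exponential at `c`, evaluated at `g x - f x`.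
    refine integral_mono (((hf.const_mul _).add hfg).const_mul _) hg fun x ↦ ?_
    have h := Real.add_one_le_exp (g x - f x - c)
    calc Real.exp c * ((1 - c) * Real.exp (f x) + (g x - f x) * Real.exp (f x))
        = Real.exp (c + f x) * (g x - f x - c + 1) := by rw [Real.exp_add]; ring
      _ ≤ Real.exp (c + f x) * Real.exp (g x - f x - c) := by gcongr
      _ = Real.exp (g x) := by rw [← Real.exp_add]; ring_nf
  rw [integral_const_mul, integral_add (hf.const_mul _) hfg, integral_const_mul] at h1
  refine le_trans ?_ h1
  rw [mul_comm]
  gcongr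
  linarith

lemma integral_mul_exp_quadratic (lam : ℝ≥0) (τ b : ℝ) (h : ℕ → ℝ) :
    ∫ n : ℕ, h n * Real.exp (b * ((n : ℝ) - lam) - τ * (((n : ℝ) - lam) ^ 2 - lam))
        ∂(poissonMeasure lam) =
      Real.exp (τ * lam) *
        ∫ n : ℕ, h n * Real.exp (b * ((n : ℝ) - lam)) ∂(gaussWeightedPoisson lam τ) := by
  rw [integral_gaussWeightedPoisson, ← integral_const_mul]
  refine integral_congr_ae (Filter.Eventually.of_forall fun n ↦ ?_)
  simp only
  rw [show b * ((n : ℝ) - lam) - τ * (((n : ℝ) - lam) ^ 2 - lam) =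
    τ * lam + -τ * ((n : ℝ) - lam) ^ 2 + b * ((n : ℝ) - lam) by ring, Real.exp_add, Real.exp_add]
  ring

lemma integral_exp_quadratic (lam : ℝ≥0) (τ b : ℝ) :
    ∫ n : ℕ, Real.exp (b * ((n : ℝ) - lam) - τ * (((n : ℝ) - lam) ^ 2 - lam))
        ∂(poissonMeasure lam) =
      Real.exp (τ * lam) * mgf (fun n : ℕ ↦ (n : ℝ) - lam) (gaussWeightedPoisson lam τ) b := by
  simpa [mgf] using integral_mul_exp_quadratic lam τ b fun _ ↦ 1

lemma integrable_pow_mul_exp_quadratic (lam : ℝ≥0) {τ : ℝ} (hτ : 0 ≤ τ) (b : ℝ) (k : ℕ) :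
    Integrable (fun n : ℕ ↦ ((n : ℝ) - lam) ^ k *
      Real.exp (b * ((n : ℝ) - lam) - τ * (((n : ℝ) - lam) ^ 2 - lam))) (poissonMeasure lam) := by
  have hm : b ∈ interior
      (integrableExpSet (fun n : ℕ ↦ (n : ℝ) - lam) (poissonMeasure lam)) := by
    have : integrableExpSet (fun n : ℕ ↦ (n : ℝ) - lam) (poissonMeasure lam) = Set.univ :=
      Set.eq_univ_of_forall (integrable_exp_mul_sub_poissonMeasure lam lam)
    simp [this]
  have h := integrable_exp_neg_mul_sq_mul hτ
    (integrable_pow_mul_exp_of_mem_interior_integrableExpSet hm k)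
  refine (h.const_mul (Real.exp (τ * lam))).congr (Filter.Eventually.of_forall fun n ↦ ?_)
  simp only
  rw [show b * ((n : ℝ) - lam) - τ * (((n : ℝ) - lam) ^ 2 - lam) =
    τ * lam + -τ * ((n : ℝ) - lam) ^ 2 + b * ((n : ℝ) - lam) by ring, Real.exp_add, Real.exp_add]
  ring

lemma integrable_exp_quadratic (lam : ℝ≥0) {τ : ℝ} (hτ : 0 ≤ τ) (b : ℝ) :
    Integrable (fun n : ℕ ↦
      Real.exp (b * ((n : ℝ) - lam) - τ * (((n : ℝ) - lam) ^ 2 - lam))) (poissonMeasure lam) := by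
  simpa using integrable_pow_mul_exp_quadratic lam hτ b 0

lemma exists_critical_gaussWeightedPoisson {lam : ℝ≥0} (hlam : 0 < lam) {τ : ℝ} (hτ : 0 ≤ τ) :
    ∃ b, ∫ n : ℕ, ((n : ℝ) - lam) * Real.exp (b * ((n : ℝ) - lam))
      ∂(gaussWeightedPoisson lam τ) = 0 := by
  have := isFiniteMeasure_gaussWeightedPoisson lam hτ
  have hpos {n : ℕ} {s : Set ℕ} (hn : n ∈ s) : 0 < (gaussWeightedPoisson lam τ).real s := by
    refine ENNReal.toReal_pos (ne_of_gt ?_) (measure_ne_top _ _)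
    exact (gaussWeightedPoisson_singleton_pos hlam τ n).trans_le
      (measure_mono (Set.singleton_subset_iff.2 hn))
  obtain ⟨N, hN⟩ := exists_nat_ge ((lam : ℝ) + 1)
  exact exists_integral_mul_exp_eq_zero (integrable_exp_mul_gaussWeightedPoisson lam hτ)
    (a := 1) (c := -lam) one_pos (by simpa using hlam)
    (hpos (n := N) (by simp only [Set.mem_ofPred_eq]; linarith)) (hpos (n := 0) (by simp))

/-- Comparison of partition functions. As the law for `(τ, b)` is centred, the coefficient `b'` has
no effect on the mean of the change of exponent, which is
`(τ - σ) (v - lam)` for the variance `v` of that law. -/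
lemma integral_exp_quadratic_mul_exp_le {lam : ℝ≥0} (hlam : 0 < lam) {σ τ : ℝ} (hσ : 0 ≤ σ)
    (hστ : σ ≤ τ) {b : ℝ} (b' : ℝ)
    (hb : ∫ n : ℕ, ((n : ℝ) - lam) * Real.exp (b * ((n : ℝ) - lam))
      ∂(gaussWeightedPoisson lam τ) = 0) :
    (∫ n : ℕ, Real.exp (b * ((n : ℝ) - lam) - τ * (((n : ℝ) - lam) ^ 2 - lam))
        ∂(poissonMeasure lam)) * Real.exp (-(2 * lam ^ 2 * τ * (τ - σ))) ≤
      ∫ n : ℕ, Real.exp (b' * ((n : ℝ) - lam) - σ * (((n : ℝ) - lam) ^ 2 - lam))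
        ∂(poissonMeasure lam) := by
  have hτ := hσ.trans hστ
  have i0 := integrable_exp_quadratic lam hτ b
  have i1 := integrable_pow_mul_exp_quadratic lam hτ b 1
  have i2 := integrable_pow_mul_exp_quadratic lam hτ b 2
  simp only [pow_one] at i1
  have heq : (fun n : ℕ ↦ (b' * ((n : ℝ) - lam) - σ * (((n : ℝ) - lam) ^ 2 - lam) -
      (b * ((n : ℝ) - lam) - τ * (((n : ℝ) - lam) ^ 2 - lam))) *
        Real.exp (b * ((n : ℝ) - lam) - τ * (((n : ℝ) - lam) ^ 2 - lam))) =
      fun n : ℕ ↦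
        (b' - b) * (((n : ℝ) - lam) *
          Real.exp (b * ((n : ℝ) - lam) - τ * (((n : ℝ) - lam) ^ 2 - lam))) +
        (τ - σ) * (((n : ℝ) - lam) ^ 2 *
          Real.exp (b * ((n : ℝ) - lam) - τ * (((n : ℝ) - lam) ^ 2 - lam))) -
        (τ - σ) * lam *
          Real.exp (b * ((n : ℝ) - lam) - τ * (((n : ℝ) - lam) ^ 2 - lam)) := by
    ext n; ring
  refine integral_exp_mul_exp_le_integral_exp i0 (integrable_exp_quadratic lam hσ b') ?_ ?_
  · rw [heq]
    exact ((i1.const_mul _).add (i2.const_mul _)).sub (i0.const_mul _)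
  · have i12 : Integrable (fun n : ℕ ↦
        (b' - b) * (((n : ℝ) - lam) *
          Real.exp (b * ((n : ℝ) - lam) - τ * (((n : ℝ) - lam) ^ 2 - lam))) +
        (τ - σ) * (((n : ℝ) - lam) ^ 2 *
          Real.exp (b * ((n : ℝ) - lam) - τ * (((n : ℝ) - lam) ^ 2 - lam))))
        (poissonMeasure lam) := (i1.const_mul _).add (i2.const_mul _)
    rw [heq, integral_sub i12 (i0.const_mul _),
      integral_add (i1.const_mul _) (i2.const_mul _), integral_const_mul, integral_const_mul,
      integral_const_mul, integral_mul_exp_quadratic, integral_mul_exp_quadratic, hb,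
      integral_exp_quadratic]
    have h := le_integral_sq_mul_exp hlam hτ hb
    have h' := mul_le_mul_of_nonneg_left h
      (mul_nonneg (Real.exp_pos (τ * lam)).le (sub_nonneg.2 hστ))
    nlinarith

/-- Choosing `b` for each `τ` so that the tilted law is centred, the logarithm `G` of the partition
function satisfies `G t - G s ≤ 2 lam ^ 2 t (t - s)` and `G 0 ≤ 0`. -/
theorem exists_integral_exp_quadratic_le {lam : ℝ≥0} (hlam : 0 < lam) {τ : ℝ} (hτ : 0 ≤ τ) :
    ∃ b : ℝ, ∫ n : ℕ, Real.exp (b * ((n : ℝ) - lam) - τ * (((n : ℝ) - lam) ^ 2 - lam))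
      ∂(poissonMeasure lam) ≤ Real.exp ((lam : ℝ) ^ 2 * τ ^ 2) := by
  have hex (t : ℝ) : ∃ b, 0 ≤ t →
      ∫ n : ℕ, ((n : ℝ) - lam) * Real.exp (b * ((n : ℝ) - lam))
        ∂(gaussWeightedPoisson lam t) = 0 := by
    by_cases ht : 0 ≤ t
    · obtain ⟨b, hb⟩ := exists_critical_gaussWeightedPoisson hlam ht
      exact ⟨b, fun _ ↦ hb⟩
    · exact ⟨0, fun h ↦ absurd h ht⟩
  choose β hβ using hex
  set Z : ℝ → ℝ := fun t ↦
    ∫ n : ℕ, Real.exp (β t * ((n : ℝ) - lam) - t * (((n : ℝ) - lam) ^ 2 - lam))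
      ∂(poissonMeasure lam) with hZ
  have hpos {t : ℝ} (ht : 0 ≤ t) : 0 < Z t := by
    simp only [hZ, integral_exp_quadratic]
    exact mul_pos (Real.exp_pos _) (mgf_gaussWeightedPoisson_pos hlam ht _)
  have hstep (s t : ℝ) (hs : 0 ≤ s) (hst : s ≤ t) :
      Real.log (Z t) - Real.log (Z s) ≤ 2 * (lam : ℝ) ^ 2 * t * (t - s) := by
    have h := integral_exp_quadratic_mul_exp_le hlam hs hst (β s) (hβ t (hs.trans hst))
    have h' := Real.log_le_log (mul_pos (hpos (hs.trans hst)) (Real.exp_pos _)) h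
    rw [Real.log_mul (hpos (hs.trans hst)).ne' (Real.exp_pos _).ne', Real.log_exp] at h'
    linarith
  have h0 : Real.log (Z 0) ≤ 0 := by
    refine Real.log_nonpos (hpos le_rfl).le ?_
    simpa [hZ] using integral_exp_quadratic_mul_exp_le hlam le_rfl le_rfl 0 (hβ 0 le_rfl)
  refine ⟨β τ, (Real.log_le_iff_le_exp (hpos hτ)).1 ?_⟩
  have := le_add_mul_sq_of_sub_le hstep hτ
  linarith

/-! ### Divergence from the Poisson law -/

/-- The divergence bound in squared form. The reference measure `ν` only has to make `Y` Poisson, so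
that laws on `ℝ` and laws on `ℕ` are covered at once. -/
theorem sq_sub_variance_div_le_toReal_klDiv {α : Type*} [MeasurableSpace α] {μ ν : Measure α}
    [IsProbabilityMeasure μ] [IsProbabilityMeasure ν] {Y : α → ℝ} {lam : ℝ≥0} (hlam : 0 < lam)
    (hY : Measurable Y) (hν : ν.map Y = (poissonMeasure lam).map (Nat.cast : ℕ → ℝ))
    (hYμ : MemLp Y 2 μ) (hmean : ∫ x, Y x ∂μ = lam) (hvar : variance Y μ ≤ lam)
    (hkl : klDiv μ ν ≠ ∞) :
    ((lam : ℝ) - variance Y μ) ^ 2 / (4 * (lam : ℝ) ^ 2) ≤ (klDiv μ ν).toReal := by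
  have hl : (0 : ℝ) < lam := hlam
  set V := variance Y μ with hV
  -- This `τ` maximizes the lower bound `τ * (lam - V) - lam ^ 2 * τ ^ 2`.
  set τ : ℝ := (lam - V) / (2 * (lam : ℝ) ^ 2) with hτd
  have hτ : 0 ≤ τ := div_nonneg (sub_nonneg.2 hvar) (by positivity)
  obtain ⟨b, hb⟩ := exists_integral_exp_quadratic_le hlam hτ
  set F : ℝ → ℝ := fun y ↦ b * (y - lam) - τ * ((y - lam) ^ 2 - lam) with hF
  have hFm : Measurable fun y ↦ Real.exp (F y) := by fun_prop
  have hint : Integrable (fun x ↦ Real.exp (F (Y x))) ν := by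
    rw [show (fun x ↦ Real.exp (F (Y x))) = (fun y ↦ Real.exp (F y)) ∘ Y from rfl,
      ← integrable_map_measure hFm.aestronglyMeasurable hY.aemeasurable, hν,
      integrable_map_measure hFm.aestronglyMeasurable .of_discrete]
    exact integrable_exp_quadratic lam hτ b
  have hval : ∫ x, Real.exp (F (Y x)) ∂ν =
      ∫ n : ℕ, Real.exp (F n) ∂(poissonMeasure lam) := by
    rw [← integral_map hY.aemeasurable (f := fun y ↦ Real.exp (F y)) hFm.aestronglyMeasurable, hν,
      integral_map .of_discrete hFm.aestronglyMeasurable]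
  have j1 : Integrable (fun x ↦ Y x - lam) μ := (hYμ.integrable one_le_two).sub (integrable_const _)
  have j2 : Integrable (fun x ↦ (Y x - lam) ^ 2) μ := (hYμ.sub (memLp_const _)).integrable_sq
  have j3 : Integrable (fun x ↦ (Y x - lam) ^ 2 - lam) μ := j2.sub (integrable_const _)
  have hmeanF : ∫ x, F (Y x) ∂μ = τ * (lam - V) := by
    simp only [hF]
    rw [integral_sub (j1.const_mul _) (j3.const_mul _), integral_const_mul, integral_const_mul,
      integral_sub (hYμ.integrable one_le_two) (integrable_const _),
      integral_sub j2 (integrable_const _), hmean, hV, variance_eq_integral hY.aemeasurable, hmean]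
    simp
    ring
  have hdv := integral_sub_log_integral_exp_le_toReal_klDiv
    (f := fun x ↦ F (Y x)) ((j1.const_mul _).sub (j3.const_mul _)) hint hkl
  have hlog : Real.log (∫ x, Real.exp (F (Y x)) ∂ν) ≤ (lam : ℝ) ^ 2 * τ ^ 2 := by
    rw [hval]
    have hp : 0 < ∫ n : ℕ, Real.exp (F n) ∂(poissonMeasure lam) :=
      integral_exp_pos (integrable_exp_quadratic lam hτ b)
    exact (Real.log_le_iff_le_exp hp).2 hb
  rw [hmeanF] at hdv
  calc ((lam : ℝ) - V) ^ 2 / (4 * (lam : ℝ) ^ 2) = τ * (lam - V) - (lam : ℝ) ^ 2 * τ ^ 2 := by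
        rw [hτd]; field_simp; ring
    _ ≤ _ := by linarith

/-! ### Moments of the binomial law -/

lemma integral_natCast_binomial (n : ℕ) (p : unitInterval) :
    ∫ k, (k : ℝ) ∂(binomial n p) = n * p := by
  have h := congrArg (Polynomial.eval (p : ℝ)) (bernsteinPolynomial.sum_smul ℝ n)
  simp only [Polynomial.eval_finsetSum, bernsteinPolynomial, nsmul_eq_mul, Polynomial.eval_mul,
    Polynomial.eval_natCast, Polynomial.eval_pow, Polynomial.eval_X, Polynomial.eval_sub,
    Polynomial.eval_one] at h
  rw [integral_binomial, ← h, Nat.range_succ_eq_Iic]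
  exact Finset.sum_congr rfl fun k _ ↦ by simp only [smul_eq_mul]; ring

lemma variance_natCast_binomial (n : ℕ) (p : unitInterval) :
    variance (fun k : ℕ ↦ (k : ℝ)) (binomial n p) = n * p * (1 - p) := by
  have h := congrArg (Polynomial.eval (p : ℝ)) (bernsteinPolynomial.variance ℝ n)
  simp only [Polynomial.eval_finsetSum, bernsteinPolynomial, nsmul_eq_mul, Polynomial.eval_mul,
    Polynomial.eval_natCast, Polynomial.eval_pow, Polynomial.eval_X, Polynomial.eval_sub,
    Polynomial.eval_one] at h
  rw [variance_eq_integral .of_discrete, integral_natCast_binomial, integral_binomial, ← h,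
    Nat.range_succ_eq_Iic]
  exact Finset.sum_congr rfl fun k _ ↦ by simp only [smul_eq_mul]; ring

/-! ### The lower bounds -/

/-- Lower bound on the information divergence (in nats) from a Poisson law in terms of the
variance. The inequality of the first part is read in the extended reals, so that an infinite
variance or an infinite divergence is allowed. A real-valued `X` is compared with the Poisson law
as a law on `ℝ`; the binomial law of the second part is a law on `ℕ`. -/
theorem mainTheorem2 (lam : ℝ≥0) (hlam : 0 < lam) :
    (∀ (Ω : Type*) [MeasurableSpace Ω] (P : Measure Ω) [IsProbabilityMeasure P] (X : Ω → ℝ),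
      AEMeasurable X P →
      (∃ S : Set ℝ, S.Countable ∧ ∀ᵐ ω ∂P, X ω ∈ S) →
      Integrable X P →
      ∫ ω, X ω ∂P = (lam : ℝ) →
      (1 : EReal) - ((evariance X P / (lam : ℝ≥0∞) : ℝ≥0∞) : EReal) ≤
        2 * (((klDiv (P.map X) ((poissonMeasure lam).map (Nat.cast : ℕ → ℝ))) ^ (1 / 2 : ℝ) :
          ℝ≥0∞) : EReal)) ∧
    (∀ (n : ℕ) (p : unitInterval), 0 < n → (p : ℝ) = (lam : ℝ) / (n : ℝ) →
      ENNReal.ofReal ((lam : ℝ) ^ 2 / (4 * (n : ℝ) ^ 2)) ≤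
        klDiv (binomial n p) (poissonMeasure lam)) := by
  have hl : (0 : ℝ) < lam := hlam
  constructor
  · intro Ω _ P _ X hX _ hint hmean
    have hprob := Measure.isProbabilityMeasure_map hX
    -- For variance at least `lam`, infinite variance included, the left-hand side is not positive.
    rcases le_or_gt 1 (evariance X P / (lam : ℝ≥0∞)) with hV | hV
    · have h1 : (1 : EReal) ≤ ((evariance X P / (lam : ℝ≥0∞) : ℝ≥0∞) : EReal) := by
        exact_mod_cast hV
      exact (EReal.sub_nonpos.2 h1).trans (mul_nonneg zero_le_two (EReal.coe_ennreal_nonneg _))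
    have hlt : evariance X P < lam := by
      rwa [ENNReal.div_lt_iff (by simp [hlam.ne']) (by simp), one_mul] at hV
    have hmem : MemLp X 2 P :=
      (evariance_lt_top_iff_memLp hX.aestronglyMeasurable).1 (hlt.trans ENNReal.coe_lt_top)
    have hev : evariance X P = ENNReal.ofReal (variance X P) := hmem.ofReal_variance_eq.symm
    have hvar : variance X P < lam := by
      rw [hev, ← ENNReal.ofReal_coe_nnreal, ENNReal.ofReal_lt_ofReal_iff hl] at hlt
      exact hlt
    by_cases hkl : klDiv (P.map X) ((poissonMeasure lam).map (Nat.cast : ℕ → ℝ)) = ∞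
    · rw [hkl, ENNReal.top_rpow_of_pos (by norm_num), EReal.coe_ennreal_top,
        EReal.mul_top_of_pos (by norm_num)]
      exact le_top
    have hvmap : variance (id : ℝ → ℝ) (P.map X) = variance X P := by
      rw [variance_map aemeasurable_id hX]; rfl
    have hmain := sq_sub_variance_div_le_toReal_klDiv (μ := P.map X) (Y := id) hlam measurable_id
      (by rw [Measure.map_id])
      ((memLp_map_measure_iff aestronglyMeasurable_id hX).2 hmem)
      (by rw [integral_map hX aestronglyMeasurable_id]; exact hmean)
      (by rw [hvmap]; exact hvar.le) hkl
    rw [hvmap] at hmain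
    set K := klDiv (P.map X) ((poissonMeasure lam).map (Nat.cast : ℕ → ℝ))
    have hK : K ^ (1 / 2 : ℝ) = ENNReal.ofReal (√K.toReal) := by
      conv_lhs => rw [← ENNReal.ofReal_toReal hkl]
      rw [ENNReal.ofReal_rpow_of_nonneg ENNReal.toReal_nonneg (by norm_num), Real.sqrt_eq_rpow]
    have hdiv : evariance X P / (lam : ℝ≥0∞) = ENNReal.ofReal (variance X P / lam) := by
      rw [hev, ENNReal.ofReal_div_of_pos hl, ENNReal.ofReal_coe_nnreal]
    rw [hK, hdiv, EReal.coe_ennreal_ofReal, EReal.coe_ennreal_ofReal,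
      max_eq_left (div_nonneg (variance_nonneg _ _) hl.le), max_eq_left (Real.sqrt_nonneg _)]
    have hsqrt : (lam - variance X P) / (2 * lam) ≤ √K.toReal := by
      refine Real.le_sqrt_of_sq_le ?_
      rw [div_pow, mul_pow]
      norm_num
      exact hmain
    have hreal : 1 - variance X P / lam ≤ 2 * √K.toReal := by
      calc 1 - variance X P / lam = 2 * ((lam - variance X P) / (2 * lam)) := by field_simp
        _ ≤ _ := by gcongr
    rw [← EReal.coe_one, ← EReal.coe_sub, show (2 : EReal) = ((2 : ℝ) : EReal) from rfl,
      ← EReal.coe_mul]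
    exact EReal.coe_le_coe_iff.2 hreal
  · intro n p hn hp
    have hn' : (0 : ℝ) < n := by exact_mod_cast hn
    by_cases hkl : klDiv (binomial n p) (poissonMeasure lam) = ∞
    · simp [hkl]
    have hnp : (n : ℝ) * p = lam := by rw [hp]; field_simp
    have hvar := variance_natCast_binomial n p
    rw [hnp] at hvar
    have hmain := sq_sub_variance_div_le_toReal_klDiv (μ := binomial n p)
      (ν := poissonMeasure lam) (Y := fun k : ℕ ↦ (k : ℝ)) hlam .of_discrete rfl
      ((memLp_two_iff_integrable_sq .of_discrete).2 (integrable_binomial _))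
      (by rw [integral_natCast_binomial, hnp])
      (by rw [hvar]; nlinarith [p.2.1]) hkl
    rw [hvar] at hmain
    rw [ENNReal.ofReal_le_iff_le_toReal hkl]
    refine le_trans (le_of_eq ?_) hmain
    rw [hp]; field_simp; ring
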